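/- Let $n\ge 1$, let $\omega((u_1,v_1),(u_2,v_2))=\langle u_1,v_2\rangle-\langle u_2,v_1\rangle$ be the standard symplectic form on $\mathbb{R}^{2(n-1)}=\mathbb{R}^{n-1}\oplus\mathbb{R}^{n-1}$, and let $\mathsf{Sp}(n-1,\omega)$ be the group of real $2(n-1)\times 2(n-1)$ matrices preserving $\omega$. For a set $S$ of real $N\times N$ matrices, let $\dim S$ be the Krull dimension of $\mathbb{R}[x_{ij}]/I(S)$, where $I(S)$ is the ideal of all real polynomials in the $N^2$ matrix entries that vanish on $S$ (that is, the dimension of the Zariski closure of $S$, which is the usual dimension for real algebraic and semialgebraic sets; $\dim\emptyset=-\infty$). Proposition. The set $\mathcal{M}$ of all $P\in\mathsf{Sp}(n-1,\omega)$ for which there is some $\lambda\in(0,1]$ with $\dim\ker(P-\lambda\,\mathrm{Id})>1$, i.e. which have some eigenvalue $\lambda\in(0,1]$ of geometric multiplicity greater than $1$, has codimension at least $3$ in $\mathsf{Sp}(n-1,\omega)$: $$\dim\mathcal{M}+3\;\le\;\dim\mathsf{Sp}(n-1,\omega).$$ -/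

import Mathlib

/-- The algebraic dimension of a subset `S` of the affine space `ℝ^σ`: the Krull dimension of the
ring `ℝ[x_i : i ∈ σ] / I(S)` of polynomial functions on `S`, where `I(S)` is the ideal of all real
polynomials vanishing on `S`. This is the dimension of the Zariski closure of `S`; for real
algebraic and, more generally, semialgebraic sets it is the usual dimension. It is `⊥` exactly for
the empty set. -/
noncomputable def algebraicDim {σ : Type*} (S : Set (σ → ℝ)) : WithBot ℕ∞ :=
  ringKrullDim (MvPolynomial σ ℝ ⧸ MvPolynomial.vanishingIdeal ℝ S)

/-- The dimension of a set of real square matrices, regarded as a subset of the affine space whose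
coordinates are the matrix entries. -/
noncomputable def matrixSetDim {ι : Type*} (S : Set (Matrix ι ι ℝ)) : WithBot ℕ∞ :=
  algebraicDim ((fun (P : Matrix ι ι ℝ) (p : ι × ι) => P p.1 p.2) '' S)

/-- `S` is a subset of `M` of codimension at least `k` in `M`, that is `dim S ≤ dim M - k`
(written without subtraction; the empty set has dimension `⊥ = -∞`). -/
def HasCodimAtLeast {ι : Type*} (k : ℕ) (S M : Set (Matrix ι ι ℝ)) : Prop :=
  S ⊆ M ∧ matrixSetDim S + (k : WithBot ℕ∞) ≤ matrixSetDim M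

/-- The real symplectic group `Sp(m, ω)` as a set of `2m × 2m` matrices, `ω` being the standard
symplectic form on `ℝ^m ⊕ ℝ^m`. -/
def symplecticSet (m : ℕ) : Set (Matrix (Fin m ⊕ Fin m) (Fin m ⊕ Fin m) ℝ) :=
  {P | P ∈ Matrix.symplecticGroup (Fin m) ℝ}

/-- The geometric multiplicity of `μ` as an eigenvalue of `P`: the dimension of
`ker (P - μ Id)` (it is positive if and only if `μ` is an eigenvalue). -/
noncomputable def geometricMultiplicity {ι : Type*} [Fintype ι] [DecidableEq ι]
    (P : Matrix ι ι ℝ) (μ : ℝ) : ℕ :=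
  Module.finrank ℝ (Module.End.eigenspace (Matrix.toLin' P) μ)

/-- The set of all `P ∈ Sp(m, ω)` that have some eigenvalue in `(0, 1]` of geometric multiplicity
greater than `1`. -/
def multipleEigenvalueSet (m : ℕ) : Set (Matrix (Fin m ⊕ Fin m) (Fin m ⊕ Fin m) ℝ) :=
  {P | P ∈ symplecticSet m ∧ ∃ μ : ℝ, μ ∈ Set.Ioc (0 : ℝ) 1 ∧ 1 < geometricMultiplicity P μ}

/-! The proof is a parameter count in terms of transcendence degree, with N = 2m and m = n - 1.
Upper bound: let `P` be symplectic with independent eigenvectors u, v for the eigenvalue t. The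
Cayley transform H = J(P - D)(P + D)⁻¹ is symmetric and determines `P` rationally. On the plane
spanned by (t + D)u and (t + D)v it agrees with B = J(t - D)(t + D)⁻¹. Thus H is determined by t,
the plane (2(N - 2) parameters) and a symmetric block of size N - 2. The parameter t costs nothing
in the end: if t² = 1 it is a constant, and otherwise symmetry of H forces the nondegenerate
alternating form B - Bᵀ to vanish on the plane, which removes one parameter. So the dimension is at
most C(N - 1, 2) + 2(N - 2), which is 3 less than 2m² + m when m ≥ 1. The count is
`exists_finset_symm_apply_mem_adjoin`; `exists_symplectic_det_add_ne_zero` supplies a center D with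
constant entries. Lower bound: `le_matrixSetDim_symplecticSet` exhibits 2m² + m algebraically
independent functions on the group. -/

/-! ### Krull dimension and transcendence degree -/

/-- An injective integral ring extension preserves the Krull dimension. -/
theorem ringKrullDim_eq_of_isIntegral {R S : Type*} [CommRing R] [CommRing S] [Algebra R S]
    [Algebra.IsIntegral R S] (hinj : Function.Injective (algebraMap R S)) :
    ringKrullDim S = ringKrullDim R := by
  have : FaithfulSMul R S := (faithfulSMul_iff_algebraMap_injective R S).mpr hinj
  apply le_antisymm
  · refine Order.krullDim_le_of_strictMono (PrimeSpectrum.comap (algebraMap R S)) ?_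
    intro p q hpq
    exact Ideal.IsIntegral.comap_lt_comap (R := R) (I := p.asIdeal) (J := q.asIdeal) hpq
  · refine iSup_le fun l => ?_
    obtain ⟨P, hP, hPl⟩ : ∃ P : Ideal S, P.IsPrime ∧
        P.comap (algebraMap R S) = l.head.asIdeal := by
      obtain ⟨Q, _, hQ, hQl⟩ := Ideal.exists_ideal_over_prime_of_isIntegral (S := S)
        l.head.asIdeal ⊥ (by
          rw [Ideal.comap_bot_of_injective _ hinj]; exact bot_le)
      exact ⟨Q, hQ, hQl⟩
    have : P.LiesOver l.head.asIdeal := ⟨hPl.symm⟩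
    obtain ⟨L, hL, -⟩ := Ideal.exists_ltSeries_of_hasGoingUp l P
    rw [← hL]
    exact Order.LTSeries.length_le_krullDim L

/-- Noether normalization, together with the resulting value of the Krull dimension. -/
theorem exists_injective_mvPolynomial_ringKrullDim_eq (k R : Type*) [Field k] [CommRing R]
    [Nontrivial R] [Algebra k R] [Algebra.FiniteType k R] :
    ∃ s : ℕ, ∃ g : MvPolynomial (Fin s) k →ₐ[k] R, Function.Injective g ∧
      g.IsIntegral ∧ ringKrullDim R = s := by
  obtain ⟨s, g, hg, hint⟩ := exists_integral_inj_algHom_of_fg k R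
  refine ⟨s, g, hg, hint, ?_⟩
  algebraize [g.toRingHom]
  rw [ringKrullDim_eq_of_isIntegral (R := MvPolynomial (Fin s) k) hg,
    MvPolynomial.ringKrullDim_of_isNoetherianRing]
  simp

open IntermediateField.algebraAdjoinAdjoin in
/-- The transcendence degree bounds the number of algebraically independent elements inside a
finitely generated extension. -/
theorem card_le_of_mem_adjoin {k K ι : Type} [Field k] [Field K] [Algebra k K] [Fintype ι]
    (G : Finset K) (x : ι → K) (hx : AlgebraicIndependent k x)
    (hG : ∀ i, x i ∈ IntermediateField.adjoin k (G : Set K)) : Fintype.card ι ≤ G.card := by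
  let A := Algebra.adjoin k (G : Set K)
  let E := IntermediateField.adjoin k (G : Set K)
  have hx' : AlgebraicIndependent k (fun i => (⟨x i, hG i⟩ : E)) :=
    AlgebraicIndependent.of_comp E.val hx
  have h1 := hx'.cardinalMk_le_trdeg
  have h2 : Algebra.trdeg k E = Algebra.trdeg k A := by
    rw [← trdeg_add_eq k A (A := E), trdeg_eq_zero (R := A), add_zero]
  let G' : Set A := (Subtype.val : A → K) ⁻¹' (G : Set K)
  have halg' : Algebra.IsAlgebraic (Algebra.adjoin k G') A := by
    have htop : Algebra.adjoin k G' = ⊤ := Algebra.adjoin_adjoin_coe_preimage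
    exact ⟨fun a => isAlgebraic_algebraMap (⟨a, htop ▸ Algebra.mem_top⟩ : Algebra.adjoin k G')⟩
  have h3 : Algebra.trdeg k A ≤ Cardinal.mk G' := Algebra.IsAlgebraic.trdeg_le_cardinalMk k G'
  have h4 : Cardinal.mk G' ≤ Cardinal.mk (G : Set K) :=
    Cardinal.mk_preimage_of_injective _ _ Subtype.val_injective
  have h5 := (h1.trans_eq h2).trans (h3.trans h4)
  simpa using h5

theorem ringKrullDim_ge_of_injective {k R ι : Type} [Field k] [CommRing R] [Algebra k R]
    [Algebra.FiniteType k R] [Fintype ι] (f : MvPolynomial ι k →ₐ[k] R)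
    (hf : Function.Injective f) : (Fintype.card ι : WithBot ℕ∞) ≤ ringKrullDim R := by
  -- `R` need not be a domain; a prime contracting to 0 keeps the polynomial ring embedded in a
  -- domain quotient.
  obtain ⟨p, hp, hpf⟩ := Ideal.exists_comap_eq_of_mem_minimalPrimes_of_injective
    (f := f.toRingHom) hf ⊥ (by simp [IsDomain.minimalPrimes_eq_singleton_bot])
  refine le_trans ?_ (ringKrullDim_quotient_le p)
  obtain ⟨s, g, hg, hint, hdim⟩ := exists_injective_mvPolynomial_ringKrullDim_eq k (R ⧸ p)
  rw [hdim]
  let f' : MvPolynomial ι k →ₐ[k] R ⧸ p := (Ideal.Quotient.mkₐ k p).comp f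
  have hf' : Function.Injective f' := by
    rw [injective_iff_map_eq_zero]
    intro a ha
    have : f a ∈ p := Ideal.Quotient.eq_zero_iff_mem.mp ha
    replace this : a ∈ p.comap f.toRingHom := this
    rwa [hpf] at this
  have h1 := trdeg_le_of_injective f' hf'
  rw [MvPolynomial.trdeg_of_isDomain, Cardinal.lift_id] at h1
  have h2 : Algebra.trdeg k (R ⧸ p) ≤ s := by
    algebraize [g.toRingHom]
    have : FaithfulSMul (MvPolynomial (Fin s) k) (R ⧸ p) :=
      (faithfulSMul_iff_algebraMap_injective _ _).mpr hg
    have : IsScalarTower k (MvPolynomial (Fin s) k) (R ⧸ p) :=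
      IsScalarTower.of_algebraMap_eq fun a => (g.commutes a).symm
    rw [← trdeg_add_eq k (MvPolynomial (Fin s) k) (A := R ⧸ p),
      trdeg_eq_zero (R := MvPolynomial (Fin s) k),
      MvPolynomial.trdeg_of_isDomain, add_zero]
    simp
  have h3 := h1.trans h2
  simp at h3
  exact_mod_cast h3

theorem algebraicDim_ge_of_algebraicIndependent {σ ι : Type} [Fintype σ] [Fintype ι]
    (S : Set (σ → ℝ)) (f : ι → MvPolynomial σ ℝ)
    (hf : ∀ F : MvPolynomial ι ℝ,
      (∀ x ∈ S, MvPolynomial.eval (fun i => MvPolynomial.eval x (f i)) F = 0) → F = 0) :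
    (Fintype.card ι : WithBot ℕ∞) ≤ algebraicDim S := by
  refine ringKrullDim_ge_of_injective
    ((Ideal.Quotient.mkₐ ℝ (MvPolynomial.vanishingIdeal ℝ S)).comp (MvPolynomial.aeval f)) ?_
  rw [injective_iff_map_eq_zero]
  intro F hF
  refine hf F fun x hx => ?_
  have := Ideal.Quotient.eq_zero_iff_mem.mp hF
  have h := (MvPolynomial.mem_vanishingIdeal_iff.mp this) x hx
  rw [← h]
  rw [← MvPolynomial.coe_aeval_eq_eval, ← MvPolynomial.coe_aeval_eq_eval]
  have : (MvPolynomial.aeval x).comp (MvPolynomial.aeval f) =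
      MvPolynomial.aeval (R := ℝ) fun i => MvPolynomial.aeval x (f i) := by
    ext i; simp
  exact (DFunLike.congr_fun this F).symm

/-- The test maps start from the ring of all functions on `S`, not from the coordinate ring, so that
data chosen pointwise without any regularity, such as eigenvalues and eigenvectors, also have images
in `K`. -/
theorem algebraicDim_le_of_mem_adjoin {σ : Type} [Fintype σ] (S : Set (σ → ℝ)) (d : ℕ)
    (h : ∀ (K : Type) [Field K] [Algebra ℝ K] (φ : (S → ℝ) →ₐ[ℝ] K), ∃ G : Finset K,
      G.card ≤ d ∧ ∀ i, φ (fun x => x.1 i) ∈ IntermediateField.adjoin ℝ (G : Set K)) :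
    algebraicDim S ≤ d := by
  unfold algebraicDim
  rcases subsingleton_or_nontrivial (MvPolynomial σ ℝ ⧸ MvPolynomial.vanishingIdeal ℝ S) with hs | hs
  · rw [ringKrullDim_eq_bot_of_subsingleton]; exact bot_le
  obtain ⟨s, g, hg, -, hdim⟩ := exists_injective_mvPolynomial_ringKrullDim_eq ℝ
    (MvPolynomial σ ℝ ⧸ MvPolynomial.vanishingIdeal ℝ S)
  rw [hdim]
  let ev : MvPolynomial σ ℝ →ₐ[ℝ] (S → ℝ) := MvPolynomial.aeval fun i x => x.1 i
  have hev : ∀ (p) (x : S), ev p x = MvPolynomial.aeval x.1 p := by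
    intro p x
    have : (Pi.evalAlgHom ℝ (fun _ : S => ℝ) x).comp ev = MvPolynomial.aeval x.1 := by
      ext i; simp [ev]
    exact DFunLike.congr_fun this p
  let q : (MvPolynomial σ ℝ ⧸ MvPolynomial.vanishingIdeal ℝ S) →ₐ[ℝ] (S → ℝ) :=
    Ideal.Quotient.liftₐ _ ev fun p hp => by
      funext x
      rw [hev]
      exact MvPolynomial.mem_vanishingIdeal_iff.mp hp x.1 x.2
  have hq : Function.Injective q := by
    rw [injective_iff_map_eq_zero]
    intro a
    obtain ⟨p, rfl⟩ := Ideal.Quotient.mk_surjective a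
    intro hp
    refine Ideal.Quotient.eq_zero_iff_mem.mpr (MvPolynomial.mem_vanishingIdeal_iff.mpr ?_)
    intro x hx
    rw [← hev p ⟨x, hx⟩]
    exact congrFun hp ⟨x, hx⟩
  have hqg : Function.Injective (q.comp g) := hq.comp hg
  -- A prime of the function ring contracting to 0 keeps the Noether parameters algebraically
  -- independent in its residue field.
  obtain ⟨p, hp, hpf⟩ := Ideal.exists_comap_eq_of_mem_minimalPrimes_of_injective
    (f := (q.comp g).toRingHom) hqg ⊥ (by simp [IsDomain.minimalPrimes_eq_singleton_bot])
  let K := FractionRing ((S → ℝ) ⧸ p)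
  let φ : (S → ℝ) →ₐ[ℝ] K := (IsScalarTower.toAlgHom ℝ ((S → ℝ) ⧸ p) K).comp (Ideal.Quotient.mkₐ ℝ p)
  have hφ : ∀ a, φ a = 0 → a ∈ p := by
    intro a ha
    have : algebraMap ((S → ℝ) ⧸ p) K (Ideal.Quotient.mk p a) = 0 := ha
    rw [FaithfulSMul.algebraMap_eq_zero_iff] at this
    exact Ideal.Quotient.eq_zero_iff_mem.mp this
  obtain ⟨G, hGd, hG⟩ := h K φ
  have hmem : ∀ r, φ (q r) ∈ IntermediateField.adjoin ℝ (G : Set K) := by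
    intro r
    obtain ⟨p, rfl⟩ := Ideal.Quotient.mk_surjective r
    change φ (ev p) ∈ _
    induction p using MvPolynomial.induction_on with
    | C a =>
      have : φ (ev (MvPolynomial.C a)) = algebraMap ℝ K a := by
        rw [← MvPolynomial.algebraMap_eq, AlgHom.commutes, AlgHom.commutes]
      rw [this]
      exact IntermediateField.algebraMap_mem _ a
    | add p q hp hq => rw [map_add, map_add]; exact add_mem hp hq
    | mul_X p i hp =>
      rw [map_mul, map_mul]
      refine mul_mem hp ?_
      have : ev (MvPolynomial.X i) = fun x => x.1 i := by simp [ev]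
      rw [this]
      exact hG i
  have hind : AlgebraicIndependent ℝ (fun i : Fin s => φ (q (g (MvPolynomial.X i)))) := by
    rw [algebraicIndependent_iff_injective_aeval]
    have : MvPolynomial.aeval (fun i : Fin s => φ (q (g (MvPolynomial.X i)))) =
        φ.comp (q.comp g) := by
      ext i; simp
    rw [this, injective_iff_map_eq_zero]
    intro a ha
    have h1 : a ∈ p.comap (q.comp g).toRingHom := hφ _ ha
    rwa [hpf] at h1
  have := card_le_of_mem_adjoin G _ hind (fun i => hmem _)
  rw [Fintype.card_fin] at this
  exact_mod_cast this.trans hGd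

/-! ### Choosing a center for the Cayley transform -/

open Matrix in
/-- The matrix `1 + τ e (J e)ᵀ` of a symplectic transvection is symplectic. -/
theorem one_add_smul_vecMulVec_mem_symplecticGroup {l K : Type*} [Fintype l] [DecidableEq l]
    [Field K] (h2 : (2 : K) ≠ 0) (τ : K) (e : l ⊕ l → K) :
    1 + τ • vecMulVec e (J l K *ᵥ e) ∈ symplecticGroup l K := by
  have h0 : (J l K *ᵥ e) ⬝ᵥ e = 0 := by
    have h : (J l K *ᵥ e) ⬝ᵥ e = -((J l K *ᵥ e) ⬝ᵥ e) := by
      conv_lhs => rw [dotProduct_comm, dotProduct_mulVec, ← mulVec_transpose, J_transpose,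
        neg_mulVec, neg_dotProduct]
    have h' : (2 : K) * ((J l K *ᵥ e) ⬝ᵥ e) = 0 := by linear_combination h
    exact (mul_eq_zero.mp h').resolve_left h2
  have h1 : vecMulVec e (J l K *ᵥ e) * J l K = vecMulVec e e := by
    rw [vecMulVec_mul, ← mulVec_transpose, J_transpose, mulVec_mulVec, Matrix.neg_mul, J_squared,
      neg_neg, one_mulVec]
  have h3 : J l K * vecMulVec (J l K *ᵥ e) e = - vecMulVec e e := by
    rw [mul_vecMulVec, mulVec_mulVec, J_squared, neg_mulVec, one_mulVec, neg_vecMulVec]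
  rw [SymplecticGroup.mem_iff, transpose_add, transpose_smul, transpose_vecMulVec, transpose_one,
    Matrix.add_mul, Matrix.smul_mul, h1, Matrix.mul_add, Matrix.add_mul, Matrix.add_mul,
    Matrix.one_mul, Matrix.mul_one, Matrix.mul_smul, h3, Matrix.smul_mul, Matrix.mul_smul, Matrix.smul_mul,
    vecMulVec_mul_vecMulVec, dotProduct_comm, h0]
  simp

-- The determinant is affine in τ and nonzero at τ = 0, so it cannot vanish at both 1 and -1.
open Matrix in
theorem exists_sign_det_add_ne_zero {ι K : Type*} [Fintype ι] [DecidableEq ι] [Field K]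
    (h2 : (2 : K) ≠ 0) (A : Matrix ι ι K) (hA : A.det ≠ 0) (c r : ι → K) :
    ∃ τ : ℤˣ, (A + ((τ : ℤ) : K) • vecMulVec c r).det ≠ 0 := by
  have key : ∀ τ : K, (A + τ • vecMulVec c r).det =
      A.det * (1 + τ * (r ⬝ᵥ A⁻¹ *ᵥ c)) := by
    intro τ
    rw [← smul_vecMulVec, vecMulVec_eq Unit, det_add_replicateCol_mul_replicateRow hA.isUnit]
    congr 1
    rw [det_unique, Matrix.mul_assoc]
    simp [Matrix.mul_apply, dotProduct, mulVec, Finset.mul_sum]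
  by_contra! h
  have h1 := h 1
  have h3 := h (-1)
  rw [key, mul_eq_zero, or_iff_right hA] at h1 h3
  push_cast at h1 h3
  exact h2 (by linear_combination h1 + h3)

open Matrix in
/-- If `P + D` is singular, its kernel shrinks on composing `D` with a suitable transvection. -/
theorem exists_transvection_ker_lt {l K : Type*} [Fintype l] [DecidableEq l] [Field K]
    (h2 : (2 : K) ≠ 0) (R : Subring K) (P D : Matrix (l ⊕ l) (l ⊕ l) K)
    (hP : P ∈ symplecticGroup l K) (hD : D ∈ symplecticGroup l K) (hDR : ∀ a b, D a b ∈ R)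
    (A : Matrix (l ⊕ l) (l ⊕ l) K) (hA : (A + D).det ≠ 0) (hPD : (P + D).det = 0) :
    ∃ D' ∈ symplecticGroup l K, (∀ a b, D' a b ∈ R) ∧ (A + D').det ≠ 0 ∧
      LinearMap.ker (P + D').toLin' < LinearMap.ker (P + D).toLin' := by
  obtain ⟨z, hz0, hz⟩ := exists_mulVec_eq_zero_iff.mpr hPD
  have hJz : J l K *ᵥ z ≠ 0 := by
    intro h
    apply hz0
    have h' : J l K *ᵥ (J l K *ᵥ z) = 0 := by rw [h, mulVec_zero]
    rw [mulVec_mulVec, J_squared] at h'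
    simpa [neg_mulVec] using h'
  obtain ⟨k, hk⟩ := Function.ne_iff.mp hJz
  let e : l ⊕ l → K := Pi.single k 1
  have he : e ⬝ᵥ (J l K *ᵥ z) ≠ 0 := by simpa [e] using hk
  have he' : (J l K *ᵥ e) ⬝ᵥ z ≠ 0 := by
    rwa [dotProduct_comm, dotProduct_mulVec, ← mulVec_transpose, J_transpose, neg_mulVec,
      neg_dotProduct, neg_ne_zero, dotProduct_comm]
  obtain ⟨τ, hτ⟩ := exists_sign_det_add_ne_zero h2 (A + D) hA (D *ᵥ e) (J l K *ᵥ e)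
  have hD' : D * (1 + ((τ : ℤ) : K) • vecMulVec e (J l K *ᵥ e)) =
      D + ((τ : ℤ) : K) • vecMulVec (D *ᵥ e) (J l K *ᵥ e) := by
    rw [Matrix.mul_add, Matrix.mul_one, Matrix.mul_smul, mul_vecMulVec]
  have hτ0 : ((τ : ℤ) : K) ≠ 0 := by
    rcases Int.units_eq_one_or τ with rfl | rfl <;> simp
  refine ⟨D * (1 + ((τ : ℤ) : K) • vecMulVec e (J l K *ᵥ e)),
    mul_mem hD (one_add_smul_vecMulVec_mem_symplecticGroup h2 _ _), ?_, ?_, ?_⟩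
  · rw [hD']
    intro a b
    have heR : ∀ a, e a ∈ R := fun a => by
      by_cases h : a = k
      · subst h; simp [e, one_mem]
      · simp [e, h, zero_mem]
    have hJR : ∀ a b, J l K a b ∈ R := by
      rintro (a | a) (b | b)
      · simp [J, zero_mem]
      · by_cases h : a = b <;> simp [J, h, zero_mem, one_mem]
      · by_cases h : a = b <;> simp [J, h, zero_mem, one_mem]
      · simp [J, zero_mem]
    exact add_mem (hDR a b) (mul_mem (intCast_mem R _) (mul_mem
      (sum_mem fun i _ => mul_mem (hDR _ _) (heR _))
      (sum_mem fun i _ => mul_mem (hJR _ _) (heR _))))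
  · rwa [hD', ← add_assoc]
  · rw [hD', ← add_assoc]
    have happ : ∀ x, (P + D + ((τ : ℤ) : K) • vecMulVec (D *ᵥ e) (J l K *ᵥ e)) *ᵥ x =
        (P + D) *ᵥ x + (((τ : ℤ) : K) * ((J l K *ᵥ e) ⬝ᵥ x)) • (D *ᵥ e) := by
      intro x
      rw [add_mulVec, smul_mulVec, vecMulVec_mulVec, op_smul_eq_smul, smul_smul]
    have hPz : P *ᵥ z = -(D *ᵥ z) := by
      rw [add_mulVec] at hz
      exact eq_neg_of_add_eq_zero_left hz
    -- The range of P + D is ω-orthogonal to Dz, whereas De is not. Hence De lies outside that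
    -- range, and the rank-one term cannot create new kernel.
    have horth : ((P + D)ᵀ * J l K * D) *ᵥ z = 0 := by
      rw [transpose_add, Matrix.add_mul, Matrix.add_mul, SymplecticGroup.mem_iff'.mp hD,
        add_mulVec, Matrix.mul_assoc, ← mulVec_mulVec, ← mulVec_mulVec, ← neg_neg (D *ᵥ z),
        ← hPz, mulVec_neg, mulVec_neg, mulVec_mulVec, mulVec_mulVec,
        SymplecticGroup.mem_iff'.mp hP]
      simp
    have hnot : ∀ x, (P + D) *ᵥ x ≠ D *ᵥ e := by
      intro x hx
      have h1 : (D *ᵥ e) ⬝ᵥ (J l K *ᵥ (D *ᵥ z)) = 0 := by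
        rw [← hx, ← vecMul_transpose, ← dotProduct_mulVec, mulVec_mulVec, mulVec_mulVec,
          horth, dotProduct_zero]
      rw [← vecMul_transpose, ← dotProduct_mulVec, mulVec_mulVec, mulVec_mulVec,
          SymplecticGroup.mem_iff'.mp hD] at h1
      exact he h1
    have hker : ∀ x, (P + D + ((τ : ℤ) : K) • vecMulVec (D *ᵥ e) (J l K *ᵥ e)) *ᵥ x = 0 →
        (J l K *ᵥ e) ⬝ᵥ x = 0 := by
      intro x hx
      by_contra h0
      rw [happ] at hx
      refine hnot (-(((τ : ℤ) : K) * ((J l K *ᵥ e) ⬝ᵥ x))⁻¹ • x) ?_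
      rw [mulVec_smul, eq_neg_of_add_eq_zero_left hx, neg_smul, smul_neg, neg_neg, smul_smul,
        inv_mul_cancel₀ (mul_ne_zero hτ0 h0), one_smul]
    refine lt_of_le_of_ne ?_ ?_
    · intro x hx
      rw [LinearMap.mem_ker, toLin'_apply] at hx ⊢
      have h0 := hker x hx
      rw [happ, h0] at hx
      simpa using hx
    · intro heq
      have hzm : z ∈ LinearMap.ker (P + D).toLin' := by
        rw [LinearMap.mem_ker, toLin'_apply, hz]
      rw [← heq, LinearMap.mem_ker, toLin'_apply] at hzm
      exact he' (hker z hzm)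

-- Start from D = 1 and apply transvections until the kernel of P + D is trivial. Keeping the
-- entries in `R` lets the center be constant, so that it contributes no parameters.
open Matrix in
theorem exists_symplectic_det_add_ne_zero {l K : Type*} [Fintype l] [DecidableEq l] [Field K]
    (h2 : (2 : K) ≠ 0) (R : Subring K) (P A : Matrix (l ⊕ l) (l ⊕ l) K)
    (hP : P ∈ symplecticGroup l K) (hA : (A + 1).det ≠ 0) :
    ∃ D ∈ symplecticGroup l K, (∀ a b, D a b ∈ R) ∧ (A + D).det ≠ 0 ∧ (P + D).det ≠ 0 := by
  suffices h : ∀ V : Submodule K (l ⊕ l → K), ∀ D ∈ symplecticGroup l K, (∀ a b, D a b ∈ R) →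
      (A + D).det ≠ 0 → LinearMap.ker (P + D).toLin' = V →
      ∃ D ∈ symplecticGroup l K, (∀ a b, D a b ∈ R) ∧ (A + D).det ≠ 0 ∧ (P + D).det ≠ 0 by
    refine h _ 1 (one_mem _) (fun a b => ?_) hA rfl
    by_cases h : a = b
    · rw [h, one_apply_eq]
      exact one_mem R
    · rw [one_apply_ne h]
      exact zero_mem R
  intro V
  induction V using WellFoundedLT.induction with
  | ind V ih =>
    intro D hD hDR hAD hV
    by_cases hPD : (P + D).det = 0
    · obtain ⟨D', hD', hR', hA', hlt⟩ := exists_transvection_ker_lt h2 R P D hP hD hDR A hAD hPD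
      exact ih _ (hV ▸ hlt) D' hD' hR' hA' rfl
    · exact ⟨D, hD, hDR, hAD, hPD⟩

/-! ### Matrices with entries in an intermediate field -/

section EntriesInSubfield

open Matrix

variable {k K ι : Type*} [Field k] [Field K] [Algebra k K] [Fintype ι]
  (F : IntermediateField k K)

theorem Matrix.mul_apply_mem {M N : Matrix ι ι K} (hM : ∀ a b, M a b ∈ F)
    (hN : ∀ a b, N a b ∈ F) (a b : ι) : (M * N) a b ∈ F :=
  sum_mem fun c _ => mul_mem (hM a c) (hN c b)

theorem Matrix.inv_apply_mem [DecidableEq ι] {M : Matrix ι ι K} (hM : ∀ a b, M a b ∈ F)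
    (a b : ι) : M⁻¹ a b ∈ F := by
  let M' : Matrix ι ι F := Matrix.of fun a b => ⟨M a b, hM a b⟩
  have hM' : M = (F.val : F →+* K).mapMatrix M' := by ext; rfl
  rw [inv_def, Ring.inverse_eq_inv', hM', ← RingHom.map_det, ← RingHom.map_adjugate]
  exact mul_mem (inv_mem (M'.det).2) (M'.adjugate a b).2

theorem Matrix.J_apply_mem {l : Type*} [DecidableEq l] (a b : l ⊕ l) : J l K a b ∈ F := by
  rcases a with a | a <;> rcases b with b | b
  · simp [J, zero_mem]
  · by_cases h : a = b <;> simp [J, h, zero_mem, one_mem]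
  · by_cases h : a = b <;> simp [J, h, zero_mem, one_mem]
  · simp [J, zero_mem]

theorem mem_of_dotProduct_mem [DecidableEq ι] {h u : ι → K} (i : ι) (hui : u i ≠ 0)
    (hu : u i ∈ F) (hmem : ∀ b, b ≠ i → h b * u b ∈ F) (hdot : h ⬝ᵥ u ∈ F) : h i ∈ F := by
  have h1 : h i * u i = h ⬝ᵥ u - ∑ b ∈ Finset.univ.erase i, h b * u b := by
    rw [dotProduct, ← Finset.add_sum_erase _ _ (Finset.mem_univ i)]
    ring
  have h2 : h i * u i ∈ F := by
    rw [h1]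
    exact sub_mem hdot (sum_mem fun b hb => hmem b (Finset.ne_of_mem_erase hb))
  have h3 := div_mem h2 hu
  rwa [mul_div_cancel_right₀ _ hui] at h3

/-- A symmetric matrix `H` whose products with two vectors `u`, `v` restricting to the standard
basis on the coordinates `i`, `j` are known is determined by its entries away from `i`, `j`. -/
theorem symm_apply_mem_of_mulVec_mem [DecidableEq ι] {H : Matrix ι ι K} (hH : H.IsSymm) {i j : ι}
    {u v : ι → K} (hui : u i = 1) (huj : u j = 0) (hvi : v i = 0) (hvj : v j = 1)
    (hu : ∀ b, u b ∈ F) (hv : ∀ b, v b ∈ F) (hHu : ∀ a, (H *ᵥ u) a ∈ F)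
    (hHv : ∀ a, (H *ᵥ v) a ∈ F)
    (hH' : ∀ a b, a ≠ i → a ≠ j → b ≠ i → b ≠ j → H a b ∈ F) (a b : ι) : H a b ∈ F := by
  have row : ∀ a, (∀ b, b ≠ i → b ≠ j → H a b ∈ F) → ∀ b, H a b ∈ F := by
    intro a ha b
    by_cases hbi : b = i
    · subst hbi
      refine mem_of_dotProduct_mem F (h := H a) (u := u) b (by simp [hui]) (hu b) ?_ (hHu a)
      intro c hc
      by_cases hcj : c = j
      · simp [hcj, huj, zero_mem]
      · exact mul_mem (ha c hc hcj) (hu c)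
    by_cases hbj : b = j
    · subst hbj
      refine mem_of_dotProduct_mem F (h := H a) (u := v) b (by simp [hvj]) (hv b) ?_ (hHv a)
      intro c hc
      by_cases hci : c = i
      · simp [hci, hvi, zero_mem]
      · exact mul_mem (ha c hci hc) (hv c)
    exact ha b hbi hbj
  have h1 : ∀ a, a ≠ i → a ≠ j → ∀ b, H a b ∈ F := fun a hai haj =>
    row a fun b hbi hbj => hH' a b hai haj hbi hbj
  exact row a (fun b hbi hbj => hH.apply a b ▸ h1 b hbi hbj a) b

/-- By the Cauchy–Binet identity, the 2 × 2 determinant of the pairings, which is 1, is a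
combination of the minors of (u, v). -/
theorem exists_minor_ne_zero_of_dotProduct {u v p q : ι → K} (hpu : p ⬝ᵥ u = 1)
    (hpv : p ⬝ᵥ v = 0) (hqv : q ⬝ᵥ v = 1) : ∃ i j, u i * v j - u j * v i ≠ 0 := by
  by_contra! h
  have h1 : (p ⬝ᵥ u) * (q ⬝ᵥ v) - (p ⬝ᵥ v) * (q ⬝ᵥ u) =
      ∑ i, ∑ j, p i * q j * (u i * v j - u j * v i) := by
    simp only [dotProduct, Finset.sum_mul_sum, ← Finset.sum_sub_distrib]
    exact Finset.sum_congr rfl fun i _ => Finset.sum_congr rfl fun j _ => by ring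
  simp [h, hpu, hpv, hqv] at h1

theorem card_ne_and_ne [DecidableEq ι] {i j : ι} (hij : i ≠ j) :
    Fintype.card {b : ι // b ≠ i ∧ b ≠ j} = Fintype.card ι - 2 := by
  rw [Fintype.card_subtype]
  have : (Finset.univ.filter fun b : ι => b ≠ i ∧ b ≠ j) = (Finset.univ.erase i).erase j := by
    ext b; simp [and_comm]
  rw [this, Finset.card_erase_of_mem (by simp [hij.symm]), Finset.card_erase_of_mem (by simp),
    Finset.card_univ]
  omega

end EntriesInSubfield

/-! ### The parameter count for symmetric matrices -/

section Count

open Matrix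

/-- A symmetric matrix `H` that agrees on a plane with a matrix `B` depending on one parameter `t`
lies in an extension generated by few elements, if the plane is subject to an extra condition or the
parameter is redundant. -/
theorem exists_finset_symm_apply_mem_adjoin {k K ι : Type*} [Field k] [Field K] [Algebra k K]
    [Fintype ι] {H B : Matrix ι ι K} (hH : H.IsSymm) (t : K) [DecidableEq ι]
    (hB : ∀ a b, B a b ∈ IntermediateField.adjoin k {t})
    (ht : (∃ s : k, algebraMap k K s = t) ∨ (B - Bᵀ).det ≠ 0) {u v p q : ι → K}
    (hpu : p ⬝ᵥ u = 1) (hpv : p ⬝ᵥ v = 0) (hqv : q ⬝ᵥ v = 1)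
    (hu : H *ᵥ u = B *ᵥ u) (hv : H *ᵥ v = B *ᵥ v) :
    ∃ G : Finset K, G.card ≤ (Fintype.card ι - 2 + 1).choose 2 + 2 * (Fintype.card ι - 2) ∧
      ∀ a b, H a b ∈ IntermediateField.adjoin k (G : Set K) := by
  classical
  obtain ⟨i, j, hδ⟩ := exists_minor_ne_zero_of_dotProduct hpu hpv hqv
  have hij : i ≠ j := by rintro rfl; simp at hδ
  set δ := u i * v j - u j * v i with hδdef
  -- Cramer's rule: x, y is the basis of the plane whose (i, j) coordinates are (1, 0) and (0, 1),
  -- so only N - 2 coordinates of each are free.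
  obtain ⟨x, hx⟩ : ∃ x, x = δ⁻¹ • (v j • u - u j • v) := ⟨_, rfl⟩
  obtain ⟨y, hy⟩ : ∃ y, y = δ⁻¹ • (u i • v - v i • u) := ⟨_, rfl⟩
  have hxi : x i = 1 := by
    rw [hx]; simp only [Pi.smul_apply, Pi.sub_apply, smul_eq_mul]; rw [inv_mul_eq_one₀ hδ]; ring
  have hxj : x j = 0 := by
    rw [hx]; simp only [Pi.smul_apply, Pi.sub_apply, smul_eq_mul]; ring
  have hyj : y j = 1 := by
    rw [hy]; simp only [Pi.smul_apply, Pi.sub_apply, smul_eq_mul]; rw [inv_mul_eq_one₀ hδ]; ring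
  have hyi : y i = 0 := by
    rw [hy]; simp only [Pi.smul_apply, Pi.sub_apply, smul_eq_mul]; ring
  have hHx : H *ᵥ x = B *ᵥ x := by simp only [hx, mulVec_smul, mulVec_sub, hu, hv]
  have hHy : H *ᵥ y = B *ᵥ y := by simp only [hy, mulVec_smul, mulVec_sub, hu, hv]
  have core : ∀ F : IntermediateField k K, t ∈ F → (∀ b, x b ∈ F) → (∀ b, y b ∈ F) →
      (∀ a b, a ≠ i → a ≠ j → b ≠ i → b ≠ j → H a b ∈ F) → ∀ a b, H a b ∈ F := by
    intro F htF hxF hyF hF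
    have hBF : ∀ a b, B a b ∈ F := fun a b =>
      (IntermediateField.adjoin_simple_le_iff.mpr htF) (hB a b)
    refine symm_apply_mem_of_mulVec_mem F hH hxi hxj hyi hyj hxF hyF ?_ ?_ hF
    · intro a; rw [hHx]; exact sum_mem fun b _ => mul_mem (hBF a b) (hxF b)
    · intro a; rw [hHy]; exact sum_mem fun b _ => mul_mem (hBF a b) (hyF b)
  let T := {b : ι // b ≠ i ∧ b ≠ j}
  have hT : Fintype.card T = Fintype.card ι - 2 := card_ne_and_ne hij
  rw [← hT]
  let hs : Sym2 T → K := Sym2.lift ⟨fun a b => H a b, fun a b => hH.apply _ _⟩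
  let G₁ : Finset K := Finset.univ.image hs
  let G₂ : Finset K := Finset.univ.image fun b : T => x b
  have hG₁ : G₁.card ≤ (Fintype.card T + 1).choose 2 := by
    refine Finset.card_image_le.trans ?_
    rw [Finset.card_univ, Sym2.card]
  have hG₂ : G₂.card ≤ Fintype.card T := Finset.card_image_le
  have mem₁ : ∀ F : IntermediateField k K, (G₁ : Set K) ⊆ F →
      ∀ a b, a ≠ i → a ≠ j → b ≠ i → b ≠ j → H a b ∈ F := by
    intro F hF a b hai haj hbi hbj
    refine hF (Finset.mem_coe.mpr (Finset.mem_image.mpr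
      ⟨s((⟨a, hai, haj⟩ : T), ⟨b, hbi, hbj⟩), Finset.mem_univ _, rfl⟩))
  have mem₂ : ∀ F : IntermediateField k K, (G₂ : Set K) ⊆ F → ∀ b, x b ∈ F := by
    intro F hF b
    by_cases hbi : b = i
    · rw [hbi, hxi]; exact one_mem F
    by_cases hbj : b = j
    · rw [hbj, hxj]; exact zero_mem F
    exact hF (Finset.mem_coe.mpr (Finset.mem_image.mpr ⟨(⟨b, hbi, hbj⟩ : T), Finset.mem_univ _, rfl⟩))
  rcases ht with ⟨s, rfl⟩ | hdet
  · let G₃ : Finset K := Finset.univ.image fun b : T => y b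
    have hG₃ : G₃.card ≤ Fintype.card T := Finset.card_image_le
    refine ⟨G₁ ∪ G₂ ∪ G₃, ?_, ?_⟩
    · have h1 := Finset.card_union_le (G₁ ∪ G₂) G₃
      have h2 := Finset.card_union_le G₁ G₂
      omega
    · have hsub := IntermediateField.subset_adjoin k ((G₁ ∪ G₂ ∪ G₃ : Finset K) : Set K)
      rw [Finset.coe_union, Finset.coe_union, Set.union_subset_iff, Set.union_subset_iff] at hsub
      obtain ⟨⟨h1, h2⟩, h3⟩ := hsub
      rw [Finset.coe_union, Finset.coe_union]
      refine core _ (IntermediateField.algebraMap_mem _ s) (mem₂ _ h2) ?_ (mem₁ _ h1)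
      intro b
      by_cases hbi : b = i
      · rw [hbi, hyi]; exact zero_mem _
      by_cases hbj : b = j
      · rw [hbj, hyj]; exact one_mem _
      exact h3 (Finset.mem_coe.mpr
        (Finset.mem_image.mpr ⟨(⟨b, hbi, hbj⟩ : T), Finset.mem_univ _, rfl⟩))
  -- Symmetry of H makes the plane isotropic for B - Bᵀ. This linear relation on y recovers one
  -- coordinate y c and pays for the generator t.
  · have hαy : (x ᵥ* (B - Bᵀ)) ⬝ᵥ y = 0 := by
      rw [← dotProduct_mulVec, sub_mulVec, ← hHy, dotProduct_sub, mulVec_transpose,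
        dotProduct_comm x (y ᵥ* B), ← dotProduct_mulVec, ← hHx, dotProduct_mulVec y,
        ← mulVec_transpose, hH.eq, dotProduct_comm, sub_self]
    have hαx : (x ᵥ* (B - Bᵀ)) ⬝ᵥ x = 0 := by
      rw [← dotProduct_mulVec, sub_mulVec, dotProduct_sub, mulVec_transpose,
        dotProduct_comm x (x ᵥ* B), ← dotProduct_mulVec, sub_self]
    set α := x ᵥ* (B - Bᵀ) with hα
    -- If α were supported on {i, j}, its vanishing on x and y would give α = 0, contrary to
    -- nondegeneracy.
    obtain ⟨c, hci, hcj, hc⟩ : ∃ c, c ≠ i ∧ c ≠ j ∧ α c ≠ 0 := by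
      by_contra! h0
      have hsum : ∀ w : ι → K, α ⬝ᵥ w = α i * w i + α j * w j := by
        intro w
        rw [dotProduct, ← Finset.sum_subset (Finset.subset_univ {i, j}), Finset.sum_pair hij]
        intro b _ hb
        simp only [Finset.mem_insert, Finset.mem_singleton, not_or] at hb
        rw [h0 b hb.1 hb.2, zero_mul]
      have hαi : α i = 0 := by simpa [hsum, hxi, hxj] using hαx
      have hαj : α j = 0 := by simpa [hsum, hyi, hyj] using hαy
      refine hdet (exists_vecMul_eq_zero_iff.mp ⟨x, ?_, ?_⟩)
      · intro h; rw [h] at hxi; simp at hxi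
      · rw [← hα]
        funext b
        by_cases hbi : b = i
        · rw [hbi, hαi]; rfl
        by_cases hbj : b = j
        · rw [hbj, hαj]; rfl
        exact h0 b hbi hbj
    let c' : T := ⟨c, hci, hcj⟩
    let G₃ : Finset K := (Finset.univ.erase c').image fun b : T => y b
    have hG₃ : G₃.card + 1 ≤ Fintype.card T := by
      have h1 : G₃.card ≤ (Finset.univ.erase c').card := Finset.card_image_le
      have h2 := Finset.card_erase_add_one (Finset.mem_univ c')
      rw [Finset.card_univ] at h2
      omega
    refine ⟨insert t (G₁ ∪ G₂ ∪ G₃), ?_, ?_⟩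
    · have h1 := Finset.card_union_le (G₁ ∪ G₂) G₃
      have h2 := Finset.card_union_le G₁ G₂
      have h3 := Finset.card_insert_le t (G₁ ∪ G₂ ∪ G₃)
      omega
    · have hsub := IntermediateField.subset_adjoin k
        ((insert t (G₁ ∪ G₂ ∪ G₃) : Finset K) : Set K)
      generalize hF : IntermediateField.adjoin k
        ((insert t (G₁ ∪ G₂ ∪ G₃) : Finset K) : Set K) = F at hsub ⊢
      rw [Finset.coe_insert, Finset.coe_union, Finset.coe_union, Set.insert_subset_iff,
        Set.union_subset_iff, Set.union_subset_iff] at hsub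
      obtain ⟨h0, ⟨h1, h2⟩, h3⟩ := hsub
      have hxF := mem₂ F h2
      have hBF : ∀ a b, B a b ∈ F := fun a b =>
        (IntermediateField.adjoin_simple_le_iff.mpr h0) (hB a b)
      have hαF : ∀ b, α b ∈ F := fun b =>
        sum_mem fun a _ => mul_mem (hxF a) (sub_mem (hBF a b) (hBF b a))
      have hyF : ∀ b, b ≠ c → y b ∈ F := by
        intro b hbc
        by_cases hbi : b = i
        · rw [hbi, hyi]; exact zero_mem _
        by_cases hbj : b = j
        · rw [hbj, hyj]; exact one_mem _
        exact h3 (Finset.mem_coe.mpr (Finset.mem_image.mpr ⟨(⟨b, hbi, hbj⟩ : T),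
          Finset.mem_erase.mpr ⟨fun h => hbc (congrArg Subtype.val h), Finset.mem_univ _⟩, rfl⟩))
      refine core F h0 hxF (fun b => ?_) (mem₁ F h1)
      by_cases hbc : b = c
      · rw [hbc]
        refine mem_of_dotProduct_mem F (h := y) (u := α) c hc (hαF c) (fun b hb => ?_) ?_
        · exact mul_mem (hyF b hb) (hαF b)
        · rw [dotProduct_comm, hαy]; exact zero_mem F
      · exact hyF b hbc

end Count

/-! ### The Cayley transform and the upper bound -/

section SymplecticEigenvalue

open Matrix

/-- The Cayley transform `J (P - D) (P + D)⁻¹` is symmetric. -/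
theorem isSymm_cayley {l K : Type*} [Fintype l] [DecidableEq l] [Field K]
    {P D : Matrix (l ⊕ l) (l ⊕ l) K} (hP : P ∈ symplecticGroup l K)
    (hD : D ∈ symplecticGroup l K) (hPD : (P + D).det ≠ 0) :
    (J l K * (P - D) * (P + D)⁻¹).IsSymm := by
  have hP' := SymplecticGroup.mem_iff'.mp hP
  have hD' := SymplecticGroup.mem_iff'.mp hD
  have hN : (P + D) * (P + D)⁻¹ = 1 := mul_nonsing_inv _ hPD.isUnit
  have hN' : ((P + D)⁻¹)ᵀ * (P + D)ᵀ = 1 := by rw [← transpose_mul, hN, transpose_one]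
  have hQ : ((P + D)ᵀ * J l K * (P - D)).IsSymm := by
    have h1 : (P + D)ᵀ * J l K * (P - D) = Dᵀ * J l K * P - Pᵀ * J l K * D +
        (Pᵀ * J l K * P - Dᵀ * J l K * D) := by
      rw [transpose_add]; noncomm_ring
    rw [hP', hD', sub_self, add_zero] at h1
    rw [h1, IsSymm]
    simp only [transpose_sub, transpose_mul, transpose_transpose, J_transpose]
    noncomm_ring
  have h2 : J l K * (P - D) * (P + D)⁻¹ =
      ((P + D)⁻¹)ᵀ * ((P + D)ᵀ * J l K * (P - D)) * (P + D)⁻¹ := by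
    rw [Matrix.mul_assoc ((P + D)ᵀ), ← Matrix.mul_assoc ((P + D)⁻¹ᵀ), hN', Matrix.one_mul]
  rw [h2, IsSymm, transpose_mul, transpose_mul, hQ.eq, transpose_transpose]
  simp only [Matrix.mul_assoc]

/-- `P` is recovered rationally from its Cayley transform. -/
theorem apply_mem_of_cayley_apply_mem {l k K : Type*} [Fintype l] [DecidableEq l] [Field k]
    [Field K] [Algebra k K] (h2 : (2 : K) ≠ 0) (F : IntermediateField k K)
    {P D : Matrix (l ⊕ l) (l ⊕ l) K}
    (hD : D ∈ symplecticGroup l K) (hPD : (P + D).det ≠ 0) (hDF : ∀ a b, D a b ∈ F)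
    (hHF : ∀ a b, (J l K * (P - D) * (P + D)⁻¹) a b ∈ F) (a b : l ⊕ l) : P a b ∈ F := by
  set H := J l K * (P - D) * (P + D)⁻¹ with hH
  have h3 : H * (P + D) = J l K * (P - D) := by
    rw [hH, Matrix.mul_assoc, nonsing_inv_mul _ hPD.isUnit, Matrix.mul_one]
  have h4 : (J l K - H) * P = (J l K + H) * D := by
    rw [Matrix.mul_add, Matrix.mul_sub] at h3
    rw [Matrix.sub_mul, Matrix.add_mul, eq_sub_of_add_eq h3]
    abel
  have h5 : (J l K - H) * (P + D) = (2 : K) • (J l K * D) := by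
    rw [Matrix.sub_mul, h3, two_smul]
    noncomm_ring
  have h6 : (J l K - H).det ≠ 0 := by
    intro h0
    have h7 := congrArg det h5
    rw [det_mul, h0, zero_mul, det_smul, det_mul] at h7
    have hJ := (isUnit_det_J l K).ne_zero
    have hD0 := (SymplecticGroup.symplectic_det hD).ne_zero
    exact mul_ne_zero (pow_ne_zero _ h2) (mul_ne_zero hJ hD0) h7.symm
  have h7 : P = (J l K - H)⁻¹ * ((J l K + H) * D) := by
    rw [← h4, ← Matrix.mul_assoc, nonsing_inv_mul _ h6.isUnit, Matrix.one_mul]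
  rw [h7]
  exact mul_apply_mem F
    (inv_apply_mem F fun a b => sub_mem (J_apply_mem F a b) (hHF a b))
    (mul_apply_mem F (fun a b => add_mem (J_apply_mem F a b) (hHF a b)) hDF) a b

/-- Congruence by M = t + D turns B - Bᵀ into 2(t² - 1)J. -/
theorem det_cayley_scalar_sub_transpose_ne_zero {l K : Type*} [Fintype l] [DecidableEq l] [Field K]
    (h2 : (2 : K) ≠ 0) {D : Matrix (l ⊕ l) (l ⊕ l) K} (hD : D ∈ symplecticGroup l K) {t : K}
    (ht : t ^ 2 ≠ 1) (htD : (t • (1 : Matrix (l ⊕ l) (l ⊕ l) K) + D).det ≠ 0) :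
    (J l K * (t • 1 - D) * (t • 1 + D)⁻¹ - (J l K * (t • 1 - D) * (t • 1 + D)⁻¹)ᵀ).det ≠ 0 := by
  set M := t • (1 : Matrix (l ⊕ l) (l ⊕ l) K) + D with hM
  set B := J l K * (t • 1 - D) * M⁻¹ with hB
  have hBM : B * M = J l K * (t • 1 - D) := by
    rw [hB, Matrix.mul_assoc, nonsing_inv_mul _ htD.isUnit, Matrix.mul_one]
  have hBM' : Mᵀ * Bᵀ = -((t • 1 - D)ᵀ * J l K) := by
    rw [← transpose_mul, hBM, transpose_mul, J_transpose, Matrix.mul_neg]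
  have h1 : Mᵀ * (B - Bᵀ) * M = (2 * (t ^ 2 - 1)) • J l K := by
    rw [Matrix.mul_sub, Matrix.sub_mul, hBM', Matrix.mul_assoc, hBM, hM]
    have hD' := SymplecticGroup.mem_iff'.mp hD
    simp only [transpose_add, transpose_sub, transpose_smul, transpose_one, Matrix.add_mul,
      Matrix.mul_add, Matrix.mul_sub, Matrix.sub_mul, Matrix.smul_mul, Matrix.mul_smul,
      Matrix.one_mul, Matrix.mul_one, ← Matrix.mul_assoc, Matrix.neg_mul, hD']
    module
  intro h0
  have h3 := congrArg det h1
  rw [det_mul, det_mul, h0, mul_zero, zero_mul, det_smul] at h3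
  exact mul_ne_zero (pow_ne_zero _ (mul_ne_zero h2 (sub_ne_zero.mpr ht)))
    (isUnit_det_J l K).ne_zero h3.symm

/-- The entries of a symplectic matrix with an eigenvalue of geometric multiplicity at least two
generate a field of small transcendence degree. -/
theorem exists_finset_symplectic_apply_mem_adjoin {l k K : Type*} [Fintype l] [DecidableEq l]
    [Field k] [Field K] [Algebra k K] (h2 : (2 : K) ≠ 0) {P : Matrix (l ⊕ l) (l ⊕ l) K}
    (hP : P ∈ symplecticGroup l K) {t : K} (ht : t + 1 ≠ 0) {u v p q : l ⊕ l → K}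
    (hpu : p ⬝ᵥ u = 1) (hpv : p ⬝ᵥ v = 0) (hqv : q ⬝ᵥ v = 1)
    (hu : P *ᵥ u = t • u) (hv : P *ᵥ v = t • v) :
    ∃ G : Finset K, G.card ≤ (Fintype.card (l ⊕ l) - 2 + 1).choose 2 +
      2 * (Fintype.card (l ⊕ l) - 2) ∧
      ∀ a b, P a b ∈ IntermediateField.adjoin k (G : Set K) := by
  have hdet1 : (t • (1 : Matrix (l ⊕ l) (l ⊕ l) K) + 1).det ≠ 0 := by
    have : t • (1 : Matrix (l ⊕ l) (l ⊕ l) K) + 1 = (t + 1) • 1 := by rw [add_smul, one_smul]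
    rw [this, det_smul, det_one, mul_one]
    exact pow_ne_zero _ ht
  obtain ⟨D, hD, hDk, htD, hPD⟩ := exists_symplectic_det_add_ne_zero h2 (algebraMap k K).range P
    (t • 1) hP hdet1
  have hDF : ∀ (F : IntermediateField k K) a b, D a b ∈ F := by
    intro F a b
    obtain ⟨s, hs⟩ := hDk a b
    rw [← hs]
    exact F.algebraMap_mem s
  set M := t • (1 : Matrix (l ⊕ l) (l ⊕ l) K) + D with hM
  set H := J l K * (P - D) * (P + D)⁻¹ with hH
  set B := J l K * (t • 1 - D) * M⁻¹ with hB
  have hy : ∀ w, P *ᵥ w = t • w → (P + D) *ᵥ w = M *ᵥ w := by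
    intro w hw
    rw [hM, add_mulVec, add_mulVec, hw, smul_mulVec, one_mulVec]
  have hHB : ∀ w, P *ᵥ w = t • w → H *ᵥ (M *ᵥ w) = B *ᵥ (M *ᵥ w) := by
    intro w hw
    have h3 : (P - D) *ᵥ w = (t • 1 - D) *ᵥ w := by
      rw [sub_mulVec, sub_mulVec, hw, smul_mulVec, one_mulVec]
    conv_lhs => rw [← hy w hw]
    rw [mulVec_mulVec, mulVec_mulVec, hH, hB, Matrix.mul_assoc, Matrix.mul_assoc _ _ M,
      nonsing_inv_mul _ hPD.isUnit, nonsing_inv_mul _ htD.isUnit, Matrix.mul_one, Matrix.mul_one,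
      ← mulVec_mulVec, h3, mulVec_mulVec]
  have hpair : ∀ r w : l ⊕ l → K, (r ᵥ* M⁻¹) ⬝ᵥ (M *ᵥ w) = r ⬝ᵥ w := by
    intro r w
    rw [← dotProduct_mulVec, mulVec_mulVec, nonsing_inv_mul _ htD.isUnit, one_mulVec]
  have hBk : ∀ a b, B a b ∈ IntermediateField.adjoin k {t} := by
    have ht1 : ∀ a b, (t • (1 : Matrix (l ⊕ l) (l ⊕ l) K)) a b ∈ IntermediateField.adjoin k {t} := by
      intro a b
      by_cases hab : a = b
      · subst hab
        simpa using IntermediateField.mem_adjoin_simple_self k t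
      · simp [hab, zero_mem]
    exact mul_apply_mem _ (mul_apply_mem _ (J_apply_mem _)
      fun a b => sub_mem (ht1 a b) (hDF _ a b))
      (inv_apply_mem _ fun a b => add_mem (ht1 a b) (hDF _ a b))
  have hcase : (∃ s : k, algebraMap k K s = t) ∨ (B - Bᵀ).det ≠ 0 := by
    by_cases h1 : t ^ 2 = 1
    · left
      rcases mul_self_eq_one_iff.mp (sq t ▸ h1) with h | h
      · exact ⟨1, by rw [h, map_one]⟩
      · exact ⟨-1, by rw [h, map_neg, map_one]⟩
    · right
      exact det_cayley_scalar_sub_transpose_ne_zero h2 hD h1 htD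
  obtain ⟨G, hG, hGH⟩ := exists_finset_symm_apply_mem_adjoin (isSymm_cayley hP hD hPD) t hBk hcase
    (u := M *ᵥ u) (v := M *ᵥ v) (p := p ᵥ* M⁻¹) (q := q ᵥ* M⁻¹)
    (by rw [hpair, hpu]) (by rw [hpair, hpv]) (by rw [hpair, hqv]) (hHB u hu) (hHB v hv)
  exact ⟨G, hG, apply_mem_of_cayley_apply_mem h2 _ hD hPD (hDF _) hGH⟩

/-- The dual vectors p, q express independence through equations, which survive any ring
homomorphism. -/
theorem exists_eigenvectors_of_one_lt_geometricMultiplicity {ι : Type*} [Fintype ι] [DecidableEq ι]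
    (P : Matrix ι ι ℝ) (t : ℝ) (h : 1 < geometricMultiplicity P t) :
    ∃ u v p q : ι → ℝ, p ⬝ᵥ u = 1 ∧ p ⬝ᵥ v = 0 ∧ q ⬝ᵥ v = 1 ∧
      P *ᵥ u = t • u ∧ P *ᵥ v = t • v := by
  obtain ⟨w, hw⟩ := exists_linearIndependent_of_le_finrank (R := ℝ)
    (M := Module.End.eigenspace (toLin' P) t) (n := 2) h
  have hw' : LinearIndependent ℝ fun a => (w a : ι → ℝ) :=
    hw.map' (Submodule.subtype _) (Submodule.ker_subtype _)
  obtain ⟨g, hg⟩ := LinearMap.exists_leftInverse_of_injective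
    (Fintype.linearCombination ℝ fun a => (w a : ι → ℝ))
    (LinearMap.ker_eq_bot.mpr (hw'.fintypeLinearCombination_injective))
  have hgw : ∀ a b, g (w a) b = (Pi.single a 1 : Fin 2 → ℝ) b := by
    intro a b
    have := LinearMap.congr_fun hg (Pi.single a 1)
    simp only [LinearMap.comp_apply, Fintype.linearCombination_apply_single, one_smul,
      LinearMap.id_apply] at this
    rw [this]
  have hdot : ∀ a b, (LinearMap.toMatrix' g b) ⬝ᵥ (w a : ι → ℝ) = (Pi.single a 1 : Fin 2 → ℝ) b := by
    intro a b
    rw [← hgw, ← LinearMap.toMatrix'_mulVec g]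
    rfl
  have heig : ∀ a, P *ᵥ (w a : ι → ℝ) = t • (w a : ι → ℝ) := fun a => by
    simpa using Module.End.mem_eigenspace_iff.mp (w a).2
  exact ⟨w 0, w 1, LinearMap.toMatrix' g 0, LinearMap.toMatrix' g 1, by simp [hdot], by simp [hdot],
    by simp [hdot], heig 0, heig 1⟩

theorem matrixSetDim_multipleEigenvalueSet_le (m : ℕ) :
    matrixSetDim (multipleEigenvalueSet m) ≤
      (((2 * m - 2 + 1).choose 2 + 2 * (2 * m - 2) : ℕ) : WithBot ℕ∞) := by
  classical
  unfold matrixSetDim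
  set S := (fun (P : Matrix (Fin m ⊕ Fin m) (Fin m ⊕ Fin m) ℝ)
    (p : (Fin m ⊕ Fin m) × (Fin m ⊕ Fin m)) => P p.1 p.2) ''
    multipleEigenvalueSet m
  refine algebraicDim_le_of_mem_adjoin S _ ?_
  intro K _ _ φ
  have hmem : ∀ x : S, (Matrix.of fun a b => x.1 (a, b)) ∈ multipleEigenvalueSet m := by
    rintro ⟨_, P, hP, rfl⟩
    exact hP
  have hdata : ∀ x : S, ∃ t : ℝ, ∃ u v p q : Fin m ⊕ Fin m → ℝ, t + 1 ≠ 0 ∧ p ⬝ᵥ u = 1 ∧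
      p ⬝ᵥ v = 0 ∧ q ⬝ᵥ v = 1 ∧ (Matrix.of fun a b => x.1 (a, b)) *ᵥ u = t • u ∧
      (Matrix.of fun a b => x.1 (a, b)) *ᵥ v = t • v := by
    intro x
    obtain ⟨-, t, ht, hmul⟩ := hmem x
    obtain ⟨u, v, p, q, h⟩ := exists_eigenvectors_of_one_lt_geometricMultiplicity _ t hmul
    -- Positivity of the eigenvalue enters only to exclude -1, where the initial center D = 1 would
    -- make t + D singular.
    exact ⟨t, u, v, p, q, by linarith [ht.1], h⟩
  choose t u v p q ht hpu hpv hqv hu hv using hdata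
  let P' : Matrix (Fin m ⊕ Fin m) (Fin m ⊕ Fin m) (S → ℝ) := Matrix.of fun a b x => x.1 (a, b)
  have hP' : P' ∈ symplecticGroup (Fin m) (S → ℝ) := by
    rw [SymplecticGroup.mem_iff]
    ext a b x
    have h1 := congrFun (congrFun (SymplecticGroup.mem_iff.mp (hmem x).1) a) b
    have h2 : ((P' * J (Fin m) (S → ℝ) * P'ᵀ).map (Pi.evalRingHom (fun _ : S => ℝ) x)) a b =
      ((J (Fin m) (S → ℝ)).map (Pi.evalRingHom (fun _ : S => ℝ) x)) a b := by
      rw [Matrix.map_mul, Matrix.map_mul, map_J]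
      exact h1
    exact h2
  have hPK := SymplecticGroup.map_mem hP' φ
  have hdot : ∀ (r w : S → Fin m ⊕ Fin m → ℝ) (c : ℝ), (∀ x, r x ⬝ᵥ w x = c) →
      (fun a => φ fun x => r x a) ⬝ᵥ (fun a => φ fun x => w x a) = algebraMap ℝ K c := by
    intro r w c h
    simp only [dotProduct, ← map_mul, ← map_sum]
    rw [← φ.commutes]
    congr 1
    funext x
    simpa [dotProduct] using h x
  have heig : ∀ w : S → Fin m ⊕ Fin m → ℝ,
      (∀ x : S, (Matrix.of fun a b => x.1 (a, b)) *ᵥ w x = t x • w x) →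
      P'.map φ *ᵥ (fun a => φ fun x => w x a) = φ t • (fun a => φ fun x => w x a) := by
    intro w h
    funext a
    simp only [mulVec, dotProduct, map_apply, Pi.smul_apply, smul_eq_mul, ← map_mul, ← map_sum]
    congr 1
    funext x
    simpa [mulVec, dotProduct, P'] using congrFun (h x) a
  -- Since t + 1 vanishes nowhere, it is a unit of the function ring, so φ cannot kill it.
  have htK : φ t + 1 ≠ 0 := by
    intro h0
    have h1 : φ ((t + 1) * fun x => (t x + 1)⁻¹) = 1 := by
      rw [← map_one φ]
      congr 1
      funext x
      exact mul_inv_cancel₀ (ht x)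
    rw [map_mul, map_add, map_one, h0, zero_mul] at h1
    exact zero_ne_one h1
  have h2 : (2 : K) ≠ 0 := by
    have := (map_ne_zero (algebraMap ℝ K)).mpr (two_ne_zero (α := ℝ))
    rwa [map_ofNat] at this
  obtain ⟨G, hG, hGP⟩ := exists_finset_symplectic_apply_mem_adjoin (k := ℝ) (K := K) h2 hPK htK
    ((hdot p u 1 hpu).trans (map_one _)) ((hdot p v 0 hpv).trans (map_zero _))
    ((hdot q v 1 hqv).trans (map_one _)) (heig u hu) (heig v hv)
  refine ⟨G, ?_, fun i => hGP i.1 i.2⟩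
  rwa [Fintype.card_sum, Fintype.card_fin, ← two_mul] at hG

end SymplecticEigenvalue

/-! ### The dimension of the symplectic group from below -/

section LowerBound

open Matrix

theorem fromBlocks_mem_symplecticGroup {l K : Type*} [Fintype l] [DecidableEq l] [Field K]
    (A S T : Matrix l l K) (hA : A.det ≠ 0) (hS : S.IsSymm) (hT : T.IsSymm) :
    fromBlocks A (T * A⁻¹ᵀ) (A⁻¹ᵀ * S) (A⁻¹ᵀ + A⁻¹ᵀ * S * A⁻¹ * T * A⁻¹ᵀ) ∈ symplecticGroup l K := by
  have h1 : A * A⁻¹ = 1 := mul_nonsing_inv _ hA.isUnit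
  have h2 : A⁻¹ᵀ * Aᵀ = 1 := by rw [← transpose_mul, h1, transpose_one]
  have h1' : ∀ X, A * (A⁻¹ * X) = X := fun X => by rw [← Matrix.mul_assoc, h1, Matrix.one_mul]
  rw [SymplecticGroup.mem_iff, J, fromBlocks_transpose, fromBlocks_multiply, fromBlocks_multiply]
  simp only [transpose_mul, transpose_add, transpose_transpose, hS.eq, hT.eq, Matrix.mul_assoc,
    Matrix.add_mul, Matrix.mul_add, h1, h2, h1', Matrix.mul_zero, Matrix.mul_one, Matrix.mul_neg,
    Matrix.neg_mul, zero_add, add_zero]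
  congr 1 <;> abel

/-- For blocks A, B, C with A on the diagonal, B upper right and C lower left, the functions are the
entries of A and of the symmetric matrices AᵀC and ABᵀ. They take arbitrary values subject to det A
≠ 0. -/
theorem le_matrixSetDim_symplecticSet (m : ℕ) :
    ((2 * m ^ 2 + m : ℕ) : WithBot ℕ∞) ≤ matrixSetDim (symplecticSet m) := by
  let ι := (Fin m × Fin m) ⊕ Sym2 (Fin m) ⊕ Sym2 (Fin m)
  have hcard : Fintype.card ι = 2 * m ^ 2 + m := by
    simp only [ι, Fintype.card_sum, Fintype.card_prod, Fintype.card_fin, Sym2.card]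
    have h2 : (m + 1).choose 2 * 2 = (m + 1) * m := by
      rw [Nat.choose_two_right]
      exact Nat.div_mul_cancel (by simpa [mul_comm] using (Nat.even_mul_succ_self m).two_dvd)
    nlinarith
  rw [← hcard]
  let X : (Fin m ⊕ Fin m) → (Fin m ⊕ Fin m) →
      MvPolynomial ((Fin m ⊕ Fin m) × (Fin m ⊕ Fin m)) ℝ := fun a b => MvPolynomial.X (a, b)
  let f : ι → MvPolynomial ((Fin m ⊕ Fin m) × (Fin m ⊕ Fin m)) ℝ :=
    Sum.elim (fun p => X (.inl p.1) (.inl p.2)) <| Sum.elim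
      (fun s => ∑ i, X (.inl i) (.inl (Quot.out s).1) * X (.inr i) (.inl (Quot.out s).2))
      (fun s => ∑ i, X (.inl (Quot.out s).1) (.inl i) * X (.inl (Quot.out s).2) (.inr i))
  refine algebraicDim_ge_of_algebraicIndependent _ f fun F hF => ?_
  -- Multiplying by the generic determinant covers the values with det A = 0: F * Δ vanishes
  -- everywhere.
  let Δ : MvPolynomial ι ℝ := (Matrix.of fun i j : Fin m => MvPolynomial.X (.inl (i, j))).det
  have hΔ : ∀ c, MvPolynomial.eval c Δ = (Matrix.of fun i j : Fin m => c (.inl (i, j))).det := by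
    intro c
    rw [RingHom.map_det]
    congr 1
    ext i j
    simp
  have hΔ0 : Δ ≠ 0 := by
    intro h0
    have h1 := hΔ (Sum.elim (fun p => (1 : Matrix (Fin m) (Fin m) ℝ) p.1 p.2) 0)
    rw [h0, map_zero] at h1
    have h2 : (Matrix.of fun i j : Fin m => (1 : Matrix (Fin m) (Fin m) ℝ) i j).det = 1 :=
      det_one
    exact zero_ne_one (h1.trans h2)
  refine (mul_eq_zero.mp (MvPolynomial.funext fun c => ?_ : F * Δ = 0)).resolve_right hΔ0
  rw [map_mul, map_zero, hΔ]
  set A : Matrix (Fin m) (Fin m) ℝ := Matrix.of fun i j => c (.inl (i, j)) with hA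
  by_cases hdet : A.det = 0
  · rw [hdet, mul_zero]
  let S : Matrix (Fin m) (Fin m) ℝ := Matrix.of fun i j => c (.inr (.inl s(i, j)))
  let T : Matrix (Fin m) (Fin m) ℝ := Matrix.of fun i j => c (.inr (.inr s(i, j)))
  have hS : S.IsSymm := by ext i j; simp [S, Sym2.eq_swap]
  have hT : T.IsSymm := by ext i j; simp [T, Sym2.eq_swap]
  have hP := fromBlocks_mem_symplecticGroup A S T hdet hS hT
  have hc := hF _ ⟨_, hP, rfl⟩
  have h1 : Aᵀ * (A⁻¹ᵀ * S) = S := by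
    rw [← Matrix.mul_assoc, ← transpose_mul, nonsing_inv_mul _ (Ne.isUnit hdet), transpose_one,
      Matrix.one_mul]
  have h2 : A * (T * A⁻¹ᵀ)ᵀ = T := by
    rw [transpose_mul, transpose_transpose, hT.eq, ← Matrix.mul_assoc,
      mul_nonsing_inv _ (Ne.isUnit hdet), Matrix.one_mul]
  have hout : ∀ s : Sym2 (Fin m), s((Quot.out s).1, (Quot.out s).2) = s := fun s => Quot.out_eq s
  have hval : (fun i => MvPolynomial.eval (fun p : (Fin m ⊕ Fin m) × (Fin m ⊕ Fin m) =>
      fromBlocks A (T * A⁻¹ᵀ) (A⁻¹ᵀ * S) (A⁻¹ᵀ + A⁻¹ᵀ * S * A⁻¹ * T * A⁻¹ᵀ) p.1 p.2) (f i)) = c := by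
    funext i
    rcases i with p | s | s
    · simp [f, X, hA]
    · have h3 := congrFun (congrFun h1 (Quot.out s).1) (Quot.out s).2
      simp only [f, X, Sum.elim_inr, Sum.elim_inl, map_sum, map_mul, MvPolynomial.eval_X,
        fromBlocks_apply₁₁, fromBlocks_apply₂₁]
      rw [Matrix.mul_apply] at h3
      refine h3.trans ?_
      simp only [S, Matrix.of_apply, hout]
    · have h3 := congrFun (congrFun h2 (Quot.out s).1) (Quot.out s).2
      simp only [f, X, Sum.elim_inr, map_sum, map_mul, MvPolynomial.eval_X,
        fromBlocks_apply₁₁, fromBlocks_apply₁₂]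
      rw [Matrix.mul_apply] at h3
      refine h3.trans ?_
      simp only [T, Matrix.of_apply, hout]
  rw [hval] at hc
  rw [hc, zero_mul]

end LowerBound

/-! ### Comparison of the two bounds -/

theorem mainTheorem10 (n : ℕ) (hn : 1 ≤ n) :
    HasCodimAtLeast 3 (multipleEigenvalueSet (n - 1)) (symplecticSet (n - 1)) := by
  refine ⟨fun P hP => hP.1, ?_⟩
  obtain ⟨m, rfl⟩ : ∃ m, n = m + 1 := ⟨n - 1, by omega⟩
  rw [Nat.add_sub_cancel]
  -- In size 0 the truncated subtraction makes the numerical bound useless, but the set is empty and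
  -- has dimension ⊥.
  rcases m with _ | m
  · have hempty : multipleEigenvalueSet 0 = ∅ := by
      refine Set.eq_empty_iff_forall_notMem.mpr fun P hP => ?_
      obtain ⟨-, t, -, h⟩ := hP
      have h1 : geometricMultiplicity P t ≤ 0 := by
        refine (Submodule.finrank_le _).trans ?_
        simp
      omega
    have hbot : matrixSetDim (multipleEigenvalueSet 0) = ⊥ := by
      rw [hempty, matrixSetDim, algebraicDim, Set.image_empty]
      have : Subsingleton (MvPolynomial ((Fin 0 ⊕ Fin 0) × (Fin 0 ⊕ Fin 0)) ℝ ⧸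
          MvPolynomial.vanishingIdeal ℝ (∅ : Set ((Fin 0 ⊕ Fin 0) × (Fin 0 ⊕ Fin 0) → ℝ))) := by
        rw [Ideal.Quotient.subsingleton_iff, MvPolynomial.vanishingIdeal_empty]
      exact ringKrullDim_eq_bot_of_subsingleton
    rw [hbot, WithBot.bot_add]
    exact bot_le
  · refine (add_le_add_left (matrixSetDim_multipleEigenvalueSet_le (m + 1)) _).trans
      (le_trans (le_of_eq ?_) (le_matrixSetDim_symplecticSet (m + 1)))
    have h : (2 * (m + 1) - 2 + 1).choose 2 + 2 * (2 * (m + 1) - 2) + 3 =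
        2 * (m + 1) ^ 2 + (m + 1) := by
      have h1 : 2 * (m + 1) - 2 = 2 * m := by omega
      have h2 : (2 * m + 1).choose 2 = (2 * m + 1) * m := by
        rw [Nat.choose_two_right, Nat.add_sub_cancel]
        rw [show (2 * m + 1) * (2 * m) = (2 * m + 1) * m * 2 by ring]
        exact Nat.mul_div_cancel _ two_pos
      rw [h1, h2]
      ring
    rw [← h]
    push_cast
    rfl
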